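/- Let $(\mathcal A,\le,\to,\Sigma)$ be an implicative algebra, i.e. a complete lattice $(\mathcal A,\le)$ with a binary operation $\to$, antitone in the first and monotone in the second argument and satisfying $a\to\bigwedge B=\bigwedge_{b\in B}(a\to b)$ for all $a\in\mathcal A$ and $B\subseteq\mathcal A$, together with an upward closed subset $\Sigma\subseteq\mathcal A$ that is closed under modus ponens (if $a\to b\in\Sigma$ and $a\in\Sigma$ then $b\in\Sigma$) and contains $\bigwedge_{a,b}(a\to b\to a)$ and $\bigwedge_{a,b,c}\big((a\to b\to c)\to(a\to b)\to a\to c\big)$. Let $\mathsf P:\mathsf{Set}^{op}\to\mathsf{Hey}$ be the associated implicative tripos: $\mathsf P(I)$ is the posetal reflection of the set of functions $I\to\mathcal A$ preordered by $\varphi\vdash\psi$ iff $\bigwedge_{i\in I}(\varphi(i)\to\psi(i))\in\Sigma$; for $f:I\to J$ the map $\mathsf P_f:\mathsf P(J)\to\mathsf P(I)$ is precomposition with $f$, and $\exists_f:\mathsf P(I)\to\mathsf P(J)$ is the left adjoint of $\mathsf P_f$. Put $\delta_I=\exists_{\Delta_I}(\top)\in\mathsf P(I\times I)$, where $\Delta_I$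 is the diagonal map of $I$. Let $\mathbf{Reg}_{\mathsf P}$ be the category whose objects are pairs $(A,\alpha)$ with $A$ a set and $\alpha\in\mathsf P(A)$, and whose morphisms $(A,\alpha)\to(B,\beta)$ are the $\phi\in\mathsf P(A\times B)$ such that 1. $\phi\le\mathsf P_{\pi_1}(\alpha)\wedge\mathsf P_{\pi_2}(\beta)$, 2. $\alpha\le\exists_{\pi_1}(\phi)$, 3. $\mathsf P_{\langle\pi_1,\pi_2\rangle}(\phi)\wedge\mathsf P_{\langle\pi_1,\pi_3\rangle}(\phi)\le\mathsf P_{\langle\pi_2,\pi_3\rangle}(\delta_B)$ in $\mathsf P(A\times B\times B)$. The composite of $\phi:(A,\alpha)\to(B,\beta)$ and $\psi:(B,\beta)\to(C,\gamma)$ is $\exists_{\langle\pi_1,\pi_3\rangle}(\mathsf P_{\langle\pi_1,\pi_2\rangle}(\phi)\wedge\mathsf P_{\langle\pi_2,\pi_3\rangle}(\psi))$, and the identity of $(A,\alpha)$ is $\exists_{\Delta_A}(\alpha)$. An object $(A,\alpha)$ is *strongly trackable* if for every morphism $\phi:(A,\alpha)\to(B,\beta)$ of $\mathbf{Reg}_{\mathsf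 P}$ there is a unique function $f:A\to B$ with $\alpha\le\mathsf P_{\langle\mathrm{id}_A,f\rangle}(\phi)$. It is *regular projective* if every morphism $(A,\alpha)\to Y$ of $\mathbf{Reg}_{\mathsf P}$ factors through every regular epimorphism $X\to Y$, where a regular epimorphism is a coequalizer of some parallel pair. A predicate $\varphi\in\mathsf P(I)$ is *supercompact* if, whenever $f:J\to I$ is a function and $\psi\in\mathsf P(J)$ satisfies $\varphi\le\exists_f(\psi)$, there is a function $g:I\to J$ with $\varphi\le\mathsf P_g(\psi)$ and $f\circ g=\mathrm{id}_I$. **Statement.** If $(A,\alpha)$ is a strongly trackable object of $\mathbf{Reg}_{\mathsf P}$, then $(A,\alpha)$ is regular projective in $\mathbf{Reg}_{\mathsf P}$ if and only if $\alpha$ is a supercompact predicate. -/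

import Mathlib

open CategoryTheory

universe u

/-- An implicative structure: a complete lattice with an implication that is antitone in the first
argument, monotone in the second, and commutes with arbitrary meets in the second. -/
class ImplicativeStructure (A : Type u) extends CompleteLattice A where
  imp : A → A → A
  imp_le_imp : ∀ {a a' b b' : A}, a' ≤ a → b ≤ b' → imp a b ≤ imp a' b'
  imp_sInf : ∀ (a : A) (B : Set A), imp a (sInf B) = ⨅ b ∈ B, imp a b

open ImplicativeStructure (imp)

/-- An implicative algebra: an implicative structure with a separator `sep`. -/
class ImplicativeAlgebra (A : Type u) extends ImplicativeStructure A where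
  sep : Set A
  sep_upward : ∀ {a b : A}, a ∈ sep → a ≤ b → b ∈ sep
  k_mem_sep : (⨅ (a : A) (b : A), imp a (imp b a)) ∈ sep
  s_mem_sep : (⨅ (a : A) (b : A) (c : A),
    imp (imp a (imp b c)) (imp (imp a b) (imp a c))) ∈ sep
  sep_mp : ∀ {a b : A}, imp a b ∈ sep → a ∈ sep → b ∈ sep

namespace ImplicativeAlgebra

section Calculus

variable {A : Type u} [ImplicativeAlgebra A]

/-- The conjunction `a × b`. -/
def conj (a b : A) : A := ⨅ x : A, imp (imp a (imp b x)) x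

/-- The disjunction `a + b`. -/
def disj (a b : A) : A := ⨅ x : A, imp (imp a x) (imp (imp b x) x)

/-- The existential quantification of a family of elements. -/
def ex {ι : Type*} (c : ι → A) : A := ⨅ x : A, imp (⨅ i, imp (c i) x) x

/-- A family of truth values is uniformly valid if its meet belongs to the separator, that is, if it
belongs to the uniform power separator. -/
def Valid {X : Type*} (φ : X → A) : Prop := (⨅ x, φ x) ∈ (sep : Set A)

theorem imp_iInf {ι : Type*} (a : A) (b : ι → A) : imp a (⨅ i, b i) = ⨅ i, imp a (b i) := by
  rw [iInf, ImplicativeStructure.imp_sInf, iInf_range]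

variable {X Y : Type*} {φ ψ χ γ δ : X → A}

theorem Valid.of_le {Y : Type*} {ψ : Y → A} (h : Valid φ) (hle : ∀ y, ∃ x, φ x ≤ ψ y) :
    Valid ψ :=
  sep_upward h (le_iInf fun y => by obtain ⟨x, hx⟩ := hle y; exact (iInf_le φ x).trans hx)

theorem Valid.mono (h : Valid φ) (hle : ∀ x, φ x ≤ ψ x) : Valid ψ := h.of_le fun x => ⟨x, hle x⟩

theorem valid_k (φ ψ : X → A) : Valid fun x => imp (φ x) (imp (ψ x) (φ x)) :=
  sep_upward k_mem_sep (le_iInf fun x => (iInf_le _ (φ x)).trans (iInf_le _ (ψ x)))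

theorem valid_s (φ ψ χ : X → A) : Valid fun x =>
    imp (imp (φ x) (imp (ψ x) (χ x))) (imp (imp (φ x) (ψ x)) (imp (φ x) (χ x))) :=
  sep_upward s_mem_sep (le_iInf fun x =>
    ((iInf_le _ (φ x)).trans (iInf_le _ (ψ x))).trans (iInf_le _ (χ x)))

theorem Valid.mp (h : Valid fun x => imp (φ x) (ψ x)) (h' : Valid φ) : Valid ψ := by
  refine sep_mp (sep_upward h ?_) h'
  rw [imp_iInf]
  exact le_iInf fun x => (iInf_le _ x).trans
    (ImplicativeStructure.imp_le_imp (iInf_le _ x) le_rfl)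

theorem Valid.weaken (h : Valid φ) : Valid fun x => imp (γ x) (φ x) := (valid_k φ γ).mp h

theorem Valid.mp₁ (h : Valid fun x => imp (γ x) (imp (φ x) (ψ x)))
    (h' : Valid fun x => imp (γ x) (φ x)) : Valid fun x => imp (γ x) (ψ x) :=
  ((valid_s γ φ ψ).mp h).mp h'

theorem Valid.mp₂ (h : Valid fun x => imp (γ x) (imp (δ x) (imp (φ x) (ψ x))))
    (h' : Valid fun x => imp (γ x) (imp (δ x) (φ x))) :
    Valid fun x => imp (γ x) (imp (δ x) (ψ x)) :=
  Valid.mp₁ (Valid.mp₁ (valid_s δ φ ψ).weaken h) h'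

theorem valid_id (φ : X → A) : Valid fun x => imp (φ x) (φ x) :=
  Valid.mp₁ (valid_k φ fun x => imp (φ x) (φ x)) (valid_k φ φ)

theorem Valid.trans (h : Valid fun x => imp (φ x) (ψ x)) (h' : Valid fun x => imp (ψ x) (χ x)) :
    Valid fun x => imp (φ x) (χ x) :=
  Valid.mp₁ h'.weaken h

theorem valid_app (φ χ : X → A) : Valid fun x => imp (φ x) (imp (imp (φ x) (χ x)) (χ x)) :=
  Valid.mp₂ (valid_id _).weaken (valid_k _ _)

theorem Valid.gen {ι : Type*} {ψ : X → ι → A}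
    (h : Valid fun p : X × ι => imp (φ p.1) (ψ p.1 p.2)) :
    Valid fun x => imp (φ x) (⨅ i, ψ x i) := by
  refine sep_upward h (le_iInf fun x => ?_)
  simp only [imp_iInf]
  exact le_iInf fun i => iInf_le (fun p : X × ι => imp (φ p.1) (ψ p.1 p.2)) (x, i)

theorem Valid.reindex {φ : Y → A} (h : Valid φ) (f : X → Y) : Valid fun x => φ (f x) :=
  h.of_le fun x => ⟨f x, le_rfl⟩

theorem valid_pair (φ ψ : X → A) :
    Valid fun x => imp (φ x) (imp (ψ x) (conj (φ x) (ψ x))) := by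
  have key : Valid fun p : X × A => imp (φ p.1) (imp (ψ p.1)
      (imp (imp (φ p.1) (imp (ψ p.1) p.2)) p.2)) := by
    -- `p` and `q` prove `(φ → ψ → x) → x`
    have h₁ := valid_app (fun p : X × A => φ p.1) (fun p => imp (ψ p.1) p.2)
    have h₂ := valid_app (fun p : X × A => ψ p.1) (fun p => p.2)
    -- composition, in the context consisting of `φ` and `ψ`
    have h₃ : Valid fun p : X × A => imp (imp (imp (ψ p.1) p.2) p.2)
        (imp (imp (imp (φ p.1) (imp (ψ p.1) p.2)) (imp (ψ p.1) p.2))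
          (imp (imp (φ p.1) (imp (ψ p.1) p.2)) p.2)) :=
      Valid.trans (valid_k _ _) (valid_s _ _ _)
    have h₁' := Valid.trans h₁ (valid_k _ (fun p : X × A => ψ p.1))
    exact Valid.mp₂ (Valid.trans h₂ h₃).weaken h₁'
  refine sep_upward key (le_iInf fun x => ?_)
  simp only [conj, imp_iInf]
  exact le_iInf fun a => iInf_le (fun p : X × A => imp (φ p.1) (imp (ψ p.1)
      (imp (imp (φ p.1) (imp (ψ p.1) p.2)) p.2))) (x, a)

theorem valid_fst (φ ψ : X → A) : Valid fun x => imp (conj (φ x) (ψ x)) (φ x) :=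
  Valid.mp₁ ((valid_id _).mono fun x =>
    ImplicativeStructure.imp_le_imp le_rfl (iInf_le _ (φ x))) (valid_k φ ψ).weaken

theorem valid_snd (φ ψ : X → A) : Valid fun x => imp (conj (φ x) (ψ x)) (ψ x) :=
  Valid.mp₁ ((valid_id _).mono fun x =>
    ImplicativeStructure.imp_le_imp le_rfl (iInf_le _ (ψ x))) (valid_id ψ).weaken.weaken

theorem valid_conj (h : Valid fun x => imp (γ x) (φ x)) (h' : Valid fun x => imp (γ x) (ψ x)) :
    Valid fun x => imp (γ x) (conj (φ x) (ψ x)) :=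
  Valid.mp₁ (h.trans (valid_pair φ ψ)) h'

theorem valid_curry :
    (Valid fun x => imp (γ x) (imp (φ x) (ψ x))) ↔
      Valid fun x => imp (conj (γ x) (φ x)) (ψ x) :=
  ⟨fun h => Valid.mp₁ ((valid_fst γ φ).trans h) (valid_snd γ φ),
    fun h => Valid.mp₂ h.weaken.weaken (valid_pair γ φ)⟩

theorem valid_inl (φ ψ : X → A) : Valid fun x => imp (φ x) (disj (φ x) (ψ x)) :=
  Valid.gen (φ := φ) (ψ := fun x a => imp (imp (φ x) a) (imp (imp (ψ x) a) a)) <|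
    Valid.mp₂ (valid_k _ _).weaken.weaken (valid_app _ _)

theorem valid_inr (φ ψ : X → A) : Valid fun x => imp (ψ x) (disj (φ x) (ψ x)) :=
  Valid.gen (φ := ψ) (ψ := fun x a => imp (imp (φ x) a) (imp (imp (ψ x) a) a)) <|
    (valid_app _ _).trans (valid_k _ _)

theorem valid_disj (h : Valid fun x => imp (φ x) (χ x)) (h' : Valid fun x => imp (ψ x) (χ x)) :
    Valid fun x => imp (disj (φ x) (ψ x)) (χ x) :=
  Valid.mp₁ (Valid.mp₁ ((valid_id _).mono fun x =>
    ImplicativeStructure.imp_le_imp le_rfl (iInf_le _ (χ x))) h.weaken) h'.weaken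

/-- Entailment between predicates over `X`: the preorder of the uniform power separator. -/
def Entails (φ ψ : X → A) : Prop := Valid fun x => imp (φ x) (ψ x)

instance : IsPreorder (X → A) Entails where
  refl := valid_id
  trans _ _ _ := Valid.trans

end Calculus

/-- The set `P(I)` of predicates over `I` of the implicative tripos of `A`: the posetal reflection
of the entailment preorder on `I → A`. -/
def Pred (A : Type u) [ImplicativeAlgebra A] (I : Type u) : Type u :=
  Antisymmetrization (I → A) Entails

namespace Pred

variable {A : Type u} [ImplicativeAlgebra A] {I J K : Type u}

/-- The class of a predicate. -/
def mk (φ : I → A) : Pred A I := toAntisymmetrization Entails φ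

theorem ind {p : Pred A I → Prop} (h : ∀ φ, p (mk φ)) (α : Pred A I) : p α :=
  Antisymmetrization.ind _ h α

/-- Lift a unary operation compatible with entailment. -/
def map (F : (I → A) → (J → A)) (hF : ∀ φ φ', Entails φ φ' → Entails (F φ) (F φ')) :
    Pred A I → Pred A J :=
  Quotient.lift (fun φ => mk (F φ)) fun _ _ h => Quotient.sound ⟨hF _ _ h.1, hF _ _ h.2⟩

/-- Lift a binary operation compatible with equivalence. -/
def map₂ (F : (I → A) → (I → A) → (I → A))
    (hF : ∀ φ φ' ψ ψ', AntisymmRel Entails φ φ' → AntisymmRel Entails ψ ψ' →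
      Entails (F φ ψ) (F φ' ψ')) :
    Pred A I → Pred A I → Pred A I :=
  Quotient.lift₂ (fun φ ψ => mk (F φ ψ)) fun _ _ _ _ h h' =>
    Quotient.sound ⟨hF _ _ _ _ h h', hF _ _ _ _ h.symm h'.symm⟩

instance : PartialOrder (Pred A I) where
  le := Quotient.lift₂ Entails fun _ _ _ _ h h' =>
    propext ⟨fun k => (h.2.trans k).trans h'.1, fun k => (h.1.trans k).trans h'.2⟩
  le_refl := ind valid_id
  le_trans := ind fun _ => ind fun _ => ind fun _ => Valid.trans
  le_antisymm := ind fun _ => ind fun _ h h' => Quotient.sound ⟨h, h'⟩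

theorem mk_le_mk {φ ψ : I → A} : mk φ ≤ mk ψ ↔ (⨅ i, imp (φ i) (ψ i)) ∈ (sep : Set A) := Iff.rfl

/-- The Heyting implication of `P(I)`. -/
def impl : Pred A I → Pred A I → Pred A I :=
  map₂ (fun φ ψ i => imp (φ i) (ψ i)) fun φ φ' ψ _ h h' =>
    valid_curry.2 ((Valid.mp₁ (valid_fst (fun i => imp (φ i) (ψ i)) φ')
      ((valid_snd (fun i => imp (φ i) (ψ i)) φ').trans h.2)).trans h'.1)

/-- The Heyting algebra structure of `P(I)`, computed pointwise in the implicative algebra. -/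
instance : HeytingAlgebra (Pred A I) where
  inf := map₂ (fun φ ψ i => conj (φ i) (ψ i)) fun φ _ ψ _ h h' =>
    valid_conj ((valid_fst φ ψ).trans h.1) ((valid_snd φ ψ).trans h'.1)
  sup := map₂ (fun φ ψ i => disj (φ i) (ψ i)) fun _ φ' _ ψ' h h' =>
    valid_disj (h.1.trans (valid_inl φ' ψ')) (h'.1.trans (valid_inr φ' ψ'))
  himp := impl
  top := mk fun _ => ⊤
  bot := mk fun _ => ⊥
  compl α := impl α (mk fun _ => ⊥)
  le_top := ind fun φ => (valid_id φ).mono fun _ =>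
    ImplicativeStructure.imp_le_imp le_rfl le_top
  bot_le := ind fun φ => (valid_id φ).mono fun _ =>
    ImplicativeStructure.imp_le_imp bot_le le_rfl
  inf_le_left := ind fun φ => ind fun ψ => valid_fst φ ψ
  inf_le_right := ind fun φ => ind fun ψ => valid_snd φ ψ
  le_inf := ind fun _ => ind fun _ => ind fun _ => valid_conj
  le_sup_left := ind fun φ => ind fun ψ => valid_inl φ ψ
  le_sup_right := ind fun φ => ind fun ψ => valid_inr φ ψ
  sup_le := ind fun _ => ind fun _ => ind fun _ => valid_disj
  le_himp_iff := ind fun _ => ind fun _ => ind fun _ => valid_curry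
  himp_bot _ := rfl

/-- The reindexing `P_f : P(J) → P(I)` along `f : I → J`, given by precomposition. -/
def reindex (f : I → J) : HeytingHom (Pred A J) (Pred A I) where
  toFun := map (fun φ i => φ (f i)) fun _ _ h => Valid.reindex h f
  map_sup' := ind fun _ => ind fun _ => rfl
  map_inf' := ind fun _ => ind fun _ => rfl
  map_bot' := rfl
  map_himp' := ind fun _ => ind fun _ => rfl

theorem reindex_mk (f : I → J) (φ : J → A) : reindex f (mk φ) = mk fun i => φ (f i) := rfl

theorem reindex_id (α : Pred A I) : reindex (fun i => i) α = α := by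
  induction α using ind; rfl

theorem reindex_reindex (f : I → J) (g : J → K) (α : Pred A K) :
    reindex f (reindex g α) = reindex (fun i => g (f i)) α := by
  induction α using ind; rfl

theorem reindex_mono (f : I → J) {α β : Pred A J} (h : α ≤ β) : reindex f α ≤ reindex f β :=
  OrderHomClass.mono (reindex f) h

theorem entails_ex (f : I → J) (φ : I → A) :
    Entails φ fun i => ex fun x : {x // f x = f i} => φ x := by
  refine Valid.gen (φ := φ)
    (ψ := fun i a => imp (⨅ x : {x // f x = f i}, imp (φ x) a) a) ?_
  refine (valid_app (fun p : I × A => φ p.1) (fun p => p.2)).mono fun p => ?_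
  refine ImplicativeStructure.imp_le_imp le_rfl (ImplicativeStructure.imp_le_imp ?_ le_rfl)
  exact iInf_le (fun x : {x // f x = f p.1} => imp (φ x) p.2) ⟨p.1, rfl⟩

theorem ex_entails (f : I → J) (φ : I → A) (ψ : J → A) (h : Entails φ fun i => ψ (f i)) :
    Entails (fun j => ex fun x : {x // f x = j} => φ x) ψ := by
  have h₁ : Valid fun j => ⨅ x : {x // f x = j}, imp (φ x) (ψ j) := by
    refine sep_upward h (le_iInf fun j => le_iInf fun x => ?_)
    obtain ⟨x, rfl⟩ := x
    exact iInf_le (fun i => imp (φ i) (ψ (f i))) x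
  exact Valid.mp₁ ((valid_id _).mono fun j =>
    ImplicativeStructure.imp_le_imp le_rfl (iInf_le _ (ψ j))) h₁.weaken

/-- The left adjoint `∃_f : P(I) → P(J)` of reindexing along `f : I → J`: existential quantification
over the fibres of `f`. -/
def exist (f : I → J) : Pred A I → Pred A J :=
  map (fun φ j => ex fun x : {x // f x = j} => φ x) fun _ φ' h =>
    ex_entails f _ _ (Valid.trans h (entails_ex f φ'))

/-- `∃_f` is left adjoint to `P_f`. -/
theorem gc_exist (f : I → J) : GaloisConnection (exist (A := A) f) (reindex (A := A) f) :=
  ind fun φ => ind fun ψ =>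
    ⟨fun h => (entails_ex f φ).trans (Valid.reindex h f), ex_entails f φ ψ⟩

theorem le_exist (f : I → J) (α : Pred A I) : α ≤ reindex f (exist f α) :=
  (gc_exist f).le_u_l α

theorem le_exist_apply (f : I → J) (α : Pred A I) (g : K → I) :
    reindex g α ≤ reindex (fun k => f (g k)) (exist f α) := by
  have h := reindex_mono g (le_exist f α)
  rwa [reindex_reindex] at h

/-- The Beck–Chevalley condition for the canonical pullback squares. -/
theorem reindex_exist (g : K → J) (f : I → J) (α : Pred A I) :
    reindex g (exist f α) =
      exist (fun z : {z : K × I // f z.2 = g z.1} => z.1.1) (reindex (fun z => z.1.2) α) := by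
  induction α using ind with | _ φ => ?_
  refine congrArg mk (funext fun k => ?_)
  refine iInf_congr fun a => congrArg (fun b => imp b a) ?_
  refine le_antisymm (le_iInf fun z => ?_) (le_iInf fun x => ?_)
  · obtain ⟨⟨⟨k', i⟩, h⟩, rfl⟩ := z
    exact iInf_le (fun x : {x // f x = g k'} => imp (φ x) a) ⟨i, h⟩
  · exact iInf_le (fun z : {z : {z : K × I // f z.2 = g z.1} // z.1.1 = k} =>
      imp (φ z.1.1.2) a) ⟨⟨(k, x.1), x.2⟩, rfl⟩

/-- Elimination of an existential quantifier in a context. -/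
theorem exist_elim (g : K → J) (f : I → J) (α : Pred A I) {γ δ : Pred A K}
    (h : reindex (fun z : {z : K × I // f z.2 = g z.1} => z.1.2) α ⊓ reindex (fun z => z.1.1) γ ≤
      reindex (fun z => z.1.1) δ) :
    reindex g (exist f α) ⊓ γ ≤ δ := by
  rw [← le_himp_iff, reindex_exist, gc_exist, map_himp, le_himp_iff]
  exact h

/-- The equality predicate `δ_I = ∃_Δ(⊤)` on `I`. -/
def eqPred (A : Type u) [ImplicativeAlgebra A] (I : Type u) : Pred A (I × I) :=
  exist (fun i => (i, i)) ⊤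

/-- A predicate over `I × J` is functional if `φ(i, j) ∧ φ(i, j') ≤ δ_J(j, j')`. -/
def IsFunctional (φ : Pred A (I × J)) : Prop :=
  reindex (fun p : I × J × J => (p.1, p.2.1)) φ ⊓ reindex (fun p => (p.1, p.2.2)) φ ≤
    reindex (fun p => (p.2.1, p.2.2)) (eqPred A J)

/-- Supercompact predicates. -/
def IsSupercompact (φ : Pred A I) : Prop :=
  ∀ (J : Type u) (f : J → I) (ψ : Pred A J), φ ≤ exist f ψ →
    ∃ g : I → J, φ ≤ reindex g ψ ∧ f ∘ g = id

end Pred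

open ImplicativeAlgebra.Pred

/-- Objects of the category `Reg_P`: pairs of a set and a predicate over it. -/
structure Reg (A : Type u) [ImplicativeAlgebra A] : Type (u + 1) where
  carrier : Type u
  pred : Pred A carrier

namespace Reg

variable {A : Type u} [ImplicativeAlgebra A]

/-- Morphisms of `Reg_P`: functional relations. -/
@[ext]
structure Hom (X Y : Reg A) : Type u where
  rel : Pred A (X.carrier × Y.carrier)
  le : rel ≤ reindex Prod.fst X.pred ⊓ reindex Prod.snd Y.pred
  total : X.pred ≤ exist Prod.fst rel
  functional : IsFunctional rel

section Relations

variable {I J K Z : Type u}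

/-- Relational composition. -/
def comp (φ : Pred A (I × J)) (ψ : Pred A (J × K)) : Pred A (I × K) :=
  exist (fun p : I × J × K => (p.1, p.2.2))
    (reindex (fun p => (p.1, p.2.1)) φ ⊓ reindex (fun p => (p.2.1, p.2.2)) ψ)

/-- The identity relation `∃_Δ(α)`. -/
def idRel (α : Pred A I) : Pred A (I × I) := exist (fun i => (i, i)) α

theorem comp_intro (φ : Pred A (I × J)) (ψ : Pred A (J × K)) (u : Z → I) (v : Z → J) (w : Z → K) :
    reindex (fun z => (u z, v z)) φ ⊓ reindex (fun z => (v z, w z)) ψ ≤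
      reindex (fun z => (u z, w z)) (comp φ ψ) := by
  have h := le_exist_apply (fun p : I × J × K => (p.1, p.2.2))
    (reindex (fun p => (p.1, p.2.1)) φ ⊓ reindex (fun p => (p.2.1, p.2.2)) ψ)
    (fun z => (u z, v z, w z))
  simp only [map_inf, reindex_reindex] at h
  exact h

theorem comp_elim (φ : Pred A (I × J)) (ψ : Pred A (J × K)) (u : Z → I) (w : Z → K)
    {γ δ : Pred A Z}
    (h : reindex (fun p : Z × J => (u p.1, p.2)) φ ⊓ reindex (fun p => (p.2, w p.1)) ψ ⊓
      reindex Prod.fst γ ≤ reindex Prod.fst δ) :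
    reindex (fun z => (u z, w z)) (comp φ ψ) ⊓ γ ≤ δ := by
  refine exist_elim _ _ _ ?_
  have h' := reindex_mono (fun z : {z : Z × (I × J × K) //
    (z.2.1, z.2.2.2) = (u z.1, w z.1)} => (z.1.1, z.1.2.2.1)) h
  simp only [map_inf, reindex_reindex] at h' ⊢
  have e₁ : (fun z : {z : Z × (I × J × K) // (z.2.1, z.2.2.2) = (u z.1, w z.1)} =>
      (z.1.2.1, z.1.2.2.1)) = fun z => (u z.1.1, z.1.2.2.1) :=
    funext fun z => Prod.ext (congrArg Prod.fst z.2 :) rfl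
  have e₂ : (fun z : {z : Z × (I × J × K) // (z.2.1, z.2.2.2) = (u z.1, w z.1)} =>
      (z.1.2.2.1, z.1.2.2.2)) = fun z => (z.1.2.2.1, w z.1.1) :=
    funext fun z => Prod.ext rfl (congrArg Prod.snd z.2 :)
  rw [e₁, e₂]
  exact h'

theorem idRel_elim (α : Pred A I) (u v : Z → I) {γ δ : Pred A Z}
    (h : reindex (fun z : {z // u z = v z} => u z.1) α ⊓ reindex Subtype.val γ ≤
      reindex Subtype.val δ) :
    reindex (fun z => (u z, v z)) (idRel α) ⊓ γ ≤ δ := by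
  refine exist_elim _ _ _ ?_
  have key : ∀ z : {z : Z × I // (z.2, z.2) = (u z.1, v z.1)}, u z.1.1 = v z.1.1 := fun z =>
    (congrArg Prod.fst z.2).symm.trans (congrArg Prod.snd z.2)
  have h' := reindex_mono (fun z : {z : Z × I // (z.2, z.2) = (u z.1, v z.1)} =>
    (⟨z.1.1, key z⟩ : {z // u z = v z})) h
  simp only [map_inf, reindex_reindex] at h' ⊢
  have e : (fun z : {z : Z × I // (z.2, z.2) = (u z.1, v z.1)} => z.1.2) = fun z => u z.1.1 :=
    funext fun z => (congrArg Prod.fst z.2 :)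
  rw [e]
  exact h'

theorem idRel_intro (α : Pred A I) (u : Z → I) :
    reindex u α ≤ reindex (fun z => (u z, u z)) (idRel α) :=
  le_exist_apply (fun i : I => (i, i)) α u

theorem IsFunctional.apply {φ : Pred A (I × J)} (h : IsFunctional φ) (u : Z → I) (v w : Z → J) :
    reindex (fun z => (u z, v z)) φ ⊓ reindex (fun z => (u z, w z)) φ ≤
      reindex (fun z => (v z, w z)) (eqPred A J) := by
  have h' := reindex_mono (fun z => (u z, v z, w z)) h
  simpa only [map_inf, reindex_reindex] using h'

theorem exist_fst_intro (φ : Pred A (I × J)) (u : Z → I) (v : Z → J) :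
    reindex (fun z => (u z, v z)) φ ≤ reindex u (exist Prod.fst φ) :=
  le_exist_apply Prod.fst φ fun z => (u z, v z)

theorem exist_fst_elim (φ : Pred A (I × J)) (u : Z → I) {γ δ : Pred A Z}
    (h : reindex (fun p : Z × J => (u p.1, p.2)) φ ⊓ reindex Prod.fst γ ≤ reindex Prod.fst δ) :
    reindex u (exist Prod.fst φ) ⊓ γ ≤ δ := by
  refine exist_elim _ _ _ ?_
  have h' := reindex_mono (fun z : {z : Z × (I × J) // z.2.1 = u z.1} => (z.1.1, z.1.2.2)) h
  simp only [map_inf, reindex_reindex] at h' ⊢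
  have e : (fun z : {z : Z × (I × J) // z.2.1 = u z.1} => z.1.2) =
      fun z => (u z.1.1, z.1.2.2) :=
    funext fun z => Prod.ext z.2 rfl
  rw [e]
  exact h'

end Relations

variable {X Y W : Reg A}

theorem Hom.le_left (φ : Hom X Y) {Z : Type u} (u : Z → X.carrier) (v : Z → Y.carrier) :
    Pred.reindex (fun z => (u z, v z)) φ.rel ≤ Pred.reindex u X.pred := by
  simpa only [reindex_reindex] using
    reindex_mono (fun z => (u z, v z)) (φ.le.trans inf_le_left)

theorem Hom.le_right (φ : Hom X Y) {Z : Type u} (u : Z → X.carrier) (v : Z → Y.carrier) :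
    Pred.reindex (fun z => (u z, v z)) φ.rel ≤ Pred.reindex v Y.pred := by
  simpa only [reindex_reindex] using
    reindex_mono (fun z => (u z, v z)) (φ.le.trans inf_le_right)

/-- The identity morphism. -/
def Hom.id (X : Reg A) : Hom X X where
  rel := idRel X.pred
  le := by
    rw [idRel, gc_exist]
    simp only [map_inf, reindex_reindex, reindex_id, le_inf_iff, le_refl, and_self]
  total := by
    have h := (idRel_intro X.pred fun z => z).trans
      (exist_fst_intro (idRel X.pred) (fun z => z) fun z => z)
    rwa [reindex_id, reindex_id] at h
  functional := by
    refine idRel_elim _ _ _ ?_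
    rw [inf_comm, reindex_reindex]
    refine idRel_elim _ _ _ ?_
    simp only [reindex_reindex]
    refine le_trans le_top ?_
    have h := idRel_intro (⊤ : Pred A X.carrier)
      (fun z : {z : {z : X.carrier × X.carrier × X.carrier // z.1 = z.2.1} //
        z.1.1 = z.1.2.2} => z.1.1.1)
    rw [map_top] at h
    refine h.trans (le_of_eq ?_)
    refine congrArg (fun k => reindex k (eqPred A X.carrier)) ?_
    funext z; exact Prod.ext z.1.2 z.2

/-- The composition of morphisms. -/
def Hom.comp (φ : Hom X Y) (ψ : Hom Y W) : Hom X W where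
  rel := Reg.comp φ.rel ψ.rel
  le := by
    rw [Reg.comp, gc_exist, map_inf, reindex_reindex, reindex_reindex]
    exact inf_le_inf (φ.le_left _ _) (ψ.le_right _ _)
  total := by
    refine φ.total.trans ?_
    rw [gc_exist]
    have h₁ : φ.rel ≤ reindex Prod.snd (exist Prod.fst ψ.rel) ⊓ φ.rel :=
      le_inf ((φ.le.trans inf_le_right).trans (reindex_mono _ ψ.total)) le_rfl
    refine h₁.trans (exist_fst_elim _ _ ?_)
    rw [inf_comm, reindex_reindex]
    refine (comp_intro φ.rel ψ.rel (fun z : (X.carrier × Y.carrier) × W.carrier => z.1.1)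
      (fun z => z.1.2) (fun z => z.2)).trans ?_
    exact exist_fst_intro _ _ _
  functional := by
    refine comp_elim _ _ _ _ ?_
    rw [inf_comm, reindex_reindex]
    refine comp_elim _ _ _ _ ?_
    simp only [map_inf, reindex_reindex]
    have h₁ := IsFunctional.apply φ.functional
      (fun z : ((X.carrier × W.carrier × W.carrier) × Y.carrier) × Y.carrier => z.1.1.1)
      (fun z => z.1.2) (fun z => z.2)
    refine le_trans (le_inf (le_trans ?_ h₁) le_rfl) ?_
    · exact le_inf (inf_le_right.trans inf_le_left) (inf_le_left.trans inf_le_left)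
    refine idRel_elim _ _ _ ?_
    simp only [map_inf, reindex_reindex]
    have h₂ := IsFunctional.apply ψ.functional
      (fun z : {z : ((X.carrier × W.carrier × W.carrier) × Y.carrier) × Y.carrier //
        z.1.2 = z.2} => z.1.1.2)
      (fun z => z.1.1.1.2.1) (fun z => z.1.1.1.2.2)
    refine le_trans (le_inf ?_ ?_) h₂
    · exact inf_le_right.trans (inf_le_right.trans inf_le_right)
    · refine inf_le_right.trans (inf_le_left.trans (inf_le_right.trans (le_of_eq ?_)))
      congr 1; congr 1
      funext z; exact Prod.ext z.2.symm rfl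

theorem le_of_forall_reindex {I : Type u} {φ ψ : Pred A I}
    (h : reindex (fun i => i) φ ⊓ ⊤ ≤ ψ) : φ ≤ ψ := by
  simpa only [reindex_id, inf_top_eq] using h

/-- The category `Reg_P`. -/
instance : Category.{u} (Reg A) where
  Hom := Hom
  id := Hom.id
  comp := Hom.comp
  id_comp {X Y} φ := by
    refine Hom.ext (le_antisymm (le_of_forall_reindex (comp_elim _ _ _ _ ?_)) ?_)
    · rw [map_top, inf_top_eq]
      refine idRel_elim _ _ _ ?_
      rw [reindex_reindex, reindex_reindex]
      refine inf_le_right.trans (le_of_eq ?_)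
      congr 1; congr 1
      funext z; exact Prod.ext z.2.symm rfl
    · have h := comp_intro (idRel X.pred) φ.rel (fun z : X.carrier × Y.carrier => z.1)
        (fun z => z.1) (fun z => z.2)
      refine le_trans (le_inf ?_ ?_) (h.trans (reindex_id (Reg.comp _ _)).le)
      · exact (φ.le.trans inf_le_left).trans (idRel_intro _ _)
      · exact (reindex_id _).ge
  comp_id {X Y} φ := by
    refine Hom.ext (le_antisymm (le_of_forall_reindex (comp_elim _ _ _ _ ?_)) ?_)
    · rw [map_top, inf_top_eq, inf_comm]
      refine idRel_elim _ _ _ ?_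
      rw [reindex_reindex, reindex_reindex]
      refine inf_le_right.trans (le_of_eq ?_)
      congr 1; congr 1
      funext z; exact Prod.ext rfl z.2
    · have h := comp_intro φ.rel (idRel Y.pred) (fun z : X.carrier × Y.carrier => z.1)
        (fun z => z.2) (fun z => z.2)
      refine le_trans (le_inf ?_ ?_) (h.trans (reindex_id (Reg.comp _ _)).le)
      · exact (reindex_id _).ge
      · exact (φ.le.trans inf_le_right).trans (idRel_intro _ _)
  assoc {X Y V W} φ ψ χ := by
    refine Hom.ext (le_antisymm (le_of_forall_reindex (comp_elim _ _ _ _ ?_))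
      (le_of_forall_reindex (comp_elim _ _ _ _ ?_)))
    · rw [map_top, inf_top_eq]
      refine comp_elim _ _ _ _ ?_
      simp only [reindex_reindex]
      rw [inf_assoc]
      exact (inf_le_inf le_rfl (comp_intro ψ.rel χ.rel _ _ _)).trans (comp_intro φ.rel _ _ _ _)
    · rw [map_top, inf_top_eq, inf_comm]
      refine comp_elim _ _ _ _ ?_
      simp only [reindex_reindex]
      rw [inf_comm, ← inf_assoc]
      exact (inf_le_inf (comp_intro φ.rel ψ.rel _ _ _) le_rfl).trans (comp_intro _ χ.rel _ _ _)

/-- A morphism of `Reg_P` is strongly trackable if it is tracked by a unique function. -/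
def IsStronglyTrackableHom {X Y : Reg A} (φ : X ⟶ Y) : Prop :=
  ∃! f : X.carrier → Y.carrier, X.pred ≤ reindex (fun a => (a, f a)) (Hom.rel φ)

/-- An object of `Reg_P` is strongly trackable if every morphism out of it is. -/
def IsStronglyTrackable (X : Reg A) : Prop :=
  ∀ (Y : Reg A) (φ : X ⟶ Y), IsStronglyTrackableHom φ

end Reg

end ImplicativeAlgebra

/-- An object is regular projective if morphisms out of it lift along regular epimorphisms. -/
def IsRegularProjective {C : Type*} [Category C] (P : C) : Prop :=
  ∀ ⦃X Y : C⦄ (e : X ⟶ Y) [IsRegularEpi e] (f : P ⟶ Y), ∃ g : P ⟶ X, g ≫ e = f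

/-! Regular epimorphisms of `Reg A` and existential quantifiers are linked in both directions, and
strong trackability translates between functional relations and actual functions.

If `α ≤ exist f ψ`, then `ψ' = ψ ⊓ reindex f α` still satisfies `α ≤ exist f ψ'` (Frobenius), and
the graph of `f` from `ψ'` to `α` is a regular epimorphism, namely the coequalizer of its kernel
(`isRegularEpi_ofMap`). Projectivity splits it, and a function `g` tracking the splitting gives `α ≤
reindex g ψ'`. Both `f ∘ g` and the identity function track the identity morphism, so uniqueness of
tracking makes them equal on the nose.

Conversely, a regular epimorphism `e` is surjective as a relation (`le_exist_snd_of_isRegularEpi`),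
because it factors through its image. If `f` tracks `φ`, every `a` in `α` therefore has, internally,
some `y` with `e(y, f a)`. Supercompactness chooses such a `y` by a function of `a`, whose graph is
a lift of `φ`: the composite with `e` and `φ` itself are both tracked by `f`, and a tracking
function determines the morphism (`Hom.eq_of_tracked`). -/

namespace ImplicativeAlgebra

open ImplicativeAlgebra.Pred

variable {A : Type u} [ImplicativeAlgebra A]

/-! ### Predicate calculus: Frobenius, graphs, images, equality -/

namespace Pred

variable {I J K Z : Type u}

/-- Frobenius reciprocity, in the form of strengthening the witness of an existential. -/
theorem le_exist_inf_reindex (f : I → J) {α : Pred A J} {ψ : Pred A I} (h : α ≤ exist f ψ) :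
    α ≤ exist f (ψ ⊓ reindex f α) := by
  -- Moving `α` to the right of a Heyting implication leaves the bare `exist f ψ` on the left, so
  -- the adjunction applies; reindexing preserves the implication.
  have key : exist f ψ ≤ α ⇨ exist f (ψ ⊓ reindex f α) := by
    rw [gc_exist, map_himp, le_himp_iff]
    exact le_exist f _
  exact (le_inf h le_rfl).trans (le_himp_iff.1 key)

theorem graph_intro (f : I → J) (α : Pred A I) (u : Z → I) :
    reindex u α ≤ reindex (fun z => (u z, f (u z))) (exist (fun i => (i, f i)) α) :=
  le_exist_apply (fun i => (i, f i)) α u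

/-- The fibre of `i ↦ (i, f i)` over `(u z, v z)` is empty unless `f (u z) = v z`, so it suffices to
argue over the subset where this genuine equation holds. -/
theorem graph_elim (f : I → J) (α : Pred A I) (u : Z → I) (v : Z → J) {γ δ : Pred A Z}
    (h : reindex (fun z : {z // f (u z) = v z} => u z.1) α ⊓ reindex Subtype.val γ ≤
      reindex Subtype.val δ) :
    reindex (fun z => (u z, v z)) (exist (fun i => (i, f i)) α) ⊓ γ ≤ δ := by
  refine exist_elim _ _ _ ?_
  have key : ∀ z : {z : Z × I // (z.2, f z.2) = (u z.1, v z.1)}, f (u z.1.1) = v z.1.1 := fun z =>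
    (congrArg (fun p => f p.1) z.2).symm.trans (congrArg Prod.snd z.2)
  have h' := reindex_mono (fun z : {z : Z × I // (z.2, f z.2) = (u z.1, v z.1)} =>
    (⟨z.1.1, key z⟩ : {z // f (u z) = v z})) h
  simp only [map_inf, reindex_reindex] at h' ⊢
  have e : (fun z : {z : Z × I // (z.2, f z.2) = (u z.1, v z.1)} => z.1.2) = fun z => u z.1.1 :=
    funext fun z => (congrArg Prod.fst z.2 :)
  rw [e]
  exact h'

/-- Elimination of the image of a relation under a function in the first argument. -/
theorem image_elim (f : I → J) (κ : Pred A (I × K)) (u : Z → J) (v : Z → K) {γ δ : Pred A Z}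
    (h : reindex (fun p : {p : Z × I // f p.2 = u p.1} => (p.1.2, v p.1.1)) κ ⊓
      reindex (fun p => p.1.1) γ ≤ reindex (fun p => p.1.1) δ) :
    reindex (fun z => (u z, v z)) (exist (fun p : I × K => (f p.1, p.2)) κ) ⊓ γ ≤ δ := by
  refine exist_elim _ _ _ ?_
  have h' := reindex_mono
    (fun z : {z : Z × (I × K) // (f z.2.1, z.2.2) = (u z.1, v z.1)} =>
      (⟨(z.1.1, z.1.2.1), congrArg Prod.fst z.2⟩ : {p : Z × I // f p.2 = u p.1})) h
  simp only [map_inf, reindex_reindex] at h' ⊢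
  have e : (fun z : {z : Z × (I × K) // (f z.2.1, z.2.2) = (u z.1, v z.1)} => z.1.2) =
      fun z => (z.1.2.1, v z.1.1) :=
    funext fun z => Prod.ext rfl (congrArg Prod.snd z.2 :)
  rw [e]
  exact h'

/-- Substitution of equals for equals in the second argument of a relation. -/
theorem eqPred_subst (φ : Pred A (I × J)) (u : Z → I) (v w : Z → J) :
    reindex (fun z => (v z, w z)) (eqPred A J) ⊓ reindex (fun z => (u z, v z)) φ ≤
      reindex (fun z => (u z, w z)) φ := by
  -- `eqPred` is by definition `idRel ⊤`.
  refine Reg.idRel_elim _ _ _ ?_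
  simp only [reindex_reindex]
  refine inf_le_right.trans (le_of_eq ?_)
  congr 1; congr 1
  funext z; exact Prod.ext rfl z.2

theorem eqPred_refl {γ : Pred A Z} {v w : Z → J} (h : ∀ z, v z = w z) :
    γ ≤ reindex (fun z => (v z, w z)) (eqPred A J) := by
  obtain rfl : v = w := funext h
  exact (le_top.trans (map_top (reindex v)).ge).trans (Reg.idRel_intro _ _)

end Pred

/-! ### Functional relations and tracking functions -/

namespace Reg

variable {X Y W : Reg A}

/-- The order between parallel functional relations is discrete. -/
theorem Hom.eq_of_le {φ ψ : Hom X Y} (h : φ.rel ≤ ψ.rel) : φ = ψ := by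
  refine Hom.ext (le_antisymm h ?_)
  -- Given `ψ(a, b)`, totality of `φ` supplies `b'` with `φ(a, b')`, hence `ψ(a, b')`; functionality
  -- of `ψ` identifies `b'` with `b`.
  have h₁ : ψ.rel ≤ reindex Prod.fst (exist Prod.fst φ.rel) ⊓ ψ.rel :=
    le_inf ((ψ.le.trans inf_le_left).trans (reindex_mono _ φ.total)) le_rfl
  refine h₁.trans (exist_fst_elim _ _ ?_)
  have h₂ := IsFunctional.apply ψ.functional
    (fun z : (X.carrier × Y.carrier) × Y.carrier => z.1.1) (fun z => z.2) (fun z => z.1.2)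
  refine le_trans (le_inf ((inf_le_inf (reindex_mono _ h) le_rfl).trans h₂) inf_le_left) ?_
  exact eqPred_subst φ.rel _ _ _

/-- Morphisms tracked by the same function are equal. -/
theorem Hom.eq_of_tracked {φ ψ : Hom X Y} (f : X.carrier → Y.carrier)
    (hφ : X.pred ≤ reindex (fun a => (a, f a)) φ.rel)
    (hψ : X.pred ≤ reindex (fun a => (a, f a)) ψ.rel) : φ = ψ := by
  refine Hom.eq_of_le ?_
  have h₁ : φ.rel ≤ reindex (fun p => (p.1, f p.1)) φ.rel := by
    have h := reindex_mono Prod.fst hφ (I := X.carrier × Y.carrier)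
    rw [reindex_reindex] at h
    exact (φ.le.trans inf_le_left).trans h
  have h₂ : φ.rel ≤ reindex (fun p => (p.1, f p.1)) ψ.rel := by
    have h := reindex_mono Prod.fst hψ (I := X.carrier × Y.carrier)
    rw [reindex_reindex] at h
    exact (φ.le.trans inf_le_left).trans h
  have h₃ := IsFunctional.apply φ.functional
    (fun p : X.carrier × Y.carrier => p.1) (fun p => f p.1) (fun p => p.2)
  -- If `φ(a, b)`, then also `φ(a, f a)`, so `f a` equals `b` internally and `ψ(a, f a)` becomes
  -- `ψ(a, b)`.
  have h₄ : φ.rel ≤ reindex (fun p => (f p.1, p.2)) (eqPred A Y.carrier) :=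
    (le_inf h₁ (reindex_id _).ge).trans h₃
  exact ((le_inf h₄ h₂).trans (eqPred_subst ψ.rel _ _ _)).trans (reindex_id _).le

/-- The morphism given by the graph of a function. -/
def Hom.ofMap (f : X.carrier → Y.carrier) (hf : X.pred ≤ reindex f Y.pred) : Hom X Y where
  rel := exist (fun a => (a, f a)) X.pred
  le := by
    rw [gc_exist]
    simp only [map_inf, reindex_reindex, reindex_id]
    exact le_inf le_rfl hf
  total := by
    have h := (graph_intro f X.pred fun z => z).trans
      (exist_fst_intro (exist (fun a => (a, f a)) X.pred) (fun z => z) f)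
    rwa [reindex_id, reindex_id] at h
  functional := by
    refine graph_elim _ _ _ _ ?_
    rw [inf_comm, reindex_reindex]
    refine graph_elim _ _ _ _ ?_
    simp only [reindex_reindex]
    exact eqPred_refl fun z => z.1.2.symm.trans z.2

theorem Hom.ofMap_tracked (f : X.carrier → Y.carrier) (hf : X.pred ≤ reindex f Y.pred) :
    X.pred ≤ reindex (fun a => (a, f a)) (Hom.ofMap f hf).rel := by
  have h := graph_intro f X.pred fun z => z
  rwa [reindex_id] at h

theorem Hom.comp_tracked {φ : Hom X Y} {ψ : Hom Y W} {f : X.carrier → Y.carrier}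
    {g : X.carrier → W.carrier} (hφ : X.pred ≤ reindex (fun a => (a, f a)) φ.rel)
    (hψ : X.pred ≤ reindex (fun a => (f a, g a)) ψ.rel) :
    X.pred ≤ reindex (fun a => (a, g a)) (Hom.comp φ ψ).rel :=
  (le_inf hφ hψ).trans (comp_intro φ.rel ψ.rel (fun a => a) f g)

/-! ### Surjectivity of regular epimorphisms -/

/-- Regular epimorphisms are surjective relations. -/
theorem le_exist_snd_of_isRegularEpi (e : X ⟶ Y) [IsRegularEpi e] :
    Y.pred ≤ exist Prod.snd (Hom.rel (X := X) (Y := Y) e) := by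
  let e₀ : Hom X Y := e
  -- The image of `e`: the same carrier, cut down to the values that `e` attains. The relation of
  -- `e` is also a morphism `e'` into `V`.
  let V : Reg A := ⟨Y.carrier, exist Prod.snd e₀.rel⟩
  have hV : V.pred ≤ Y.pred := by
    change exist Prod.snd e₀.rel ≤ Y.pred
    rw [gc_exist]
    exact e₀.le.trans inf_le_right
  let e' : X ⟶ V := Hom.mk (X := X) (Y := V) e₀.rel
    (le_inf (e₀.le.trans inf_le_left) (le_exist Prod.snd e₀.rel)) e₀.total e₀.functional
  let m : V ⟶ Y := Hom.ofMap (X := V) (Y := Y) (fun c => c) (by rwa [reindex_id])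
  have hm : e' ≫ m = e := by
    refine (Hom.eq_of_le (φ := e₀) ?_).symm
    have h := comp_intro e₀.rel (idRel V.pred) (fun z : X.carrier × Y.carrier => z.1)
      (fun z => z.2) (fun z => z.2)
    refine le_trans (le_inf (reindex_id _).ge ?_) (h.trans (reindex_id (Reg.comp _ _)).le)
    exact (le_exist Prod.snd e₀.rel).trans (idRel_intro _ _)
  -- The relation of a composite does not involve the predicate of the target, so `e'` coequalizes
  -- the same pair as `e`.
  have he' : IsRegularEpi.left e ≫ e' = IsRegularEpi.right e ≫ e' :=
    Hom.ext (congrArg Hom.rel (IsRegularEpi.w e) :)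
  let d : Y ⟶ V := IsRegularEpi.desc e e' he'
  have hd : e ≫ d = e' := IsRegularEpi.fac e e' he'
  have : Epi e := (IsRegularEpi.getStruct e).epi
  have hdm : d ≫ m = 𝟙 Y := by
    rw [← cancel_epi e, ← Category.assoc, hd, hm, Category.comp_id]
  -- Since `d ≫ m` is the identity, each `c` in `Y` is related to itself by a relation that passes
  -- through `m`, and `m` relates only to elements of the image `V`.
  have h₁ : Y.pred ≤ reindex (fun c : Y.carrier => (c, c)) (Hom.rel (X := Y) (Y := Y) (d ≫ m)) := by
    rw [hdm]
    have h := idRel_intro Y.pred fun c => c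
    rwa [reindex_id] at h
  have h₂ : reindex (fun c : Y.carrier => (c, c)) (Reg.comp (Hom.rel (X := Y) (Y := V) d) (idRel V.pred)) ⊓ ⊤ ≤ V.pred := by
    refine comp_elim _ _ (fun c => c) (fun c => c) ?_
    refine inf_le_left.trans (inf_le_right.trans ?_)
    have h : idRel V.pred ≤ reindex Prod.snd V.pred := by
      rw [idRel, gc_exist, reindex_reindex, reindex_id]
    have h' := reindex_mono (fun p : Y.carrier × Y.carrier => (p.2, p.1)) h
    rwa [reindex_reindex] at h'
  rw [inf_top_eq] at h₂
  exact h₁.trans h₂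

/-! ### Graphs of surjective functions as coequalizers of their kernels -/

section Quotient

variable (f : X.carrier → Y.carrier)

/-- The object of pairs of elements identified by a function. -/
def kernel : Reg A where
  carrier := {p : X.carrier × X.carrier // f p.1 = f p.2}
  pred := reindex (fun p => p.1.1) X.pred ⊓ reindex (fun p => p.1.2) X.pred

/-- The first projection of the kernel. -/
def kernelFst : kernel f ⟶ X := Hom.ofMap (X := kernel f) (Y := X) (fun p => p.1.1) inf_le_left

/-- The second projection of the kernel. -/
def kernelSnd : kernel f ⟶ X := Hom.ofMap (X := kernel f) (Y := X) (fun p => p.1.2) inf_le_right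

variable {f}

theorem kernel_condition (hf : X.pred ≤ reindex f Y.pred) :
    kernelFst f ≫ (Hom.ofMap f hf : X ⟶ Y) = kernelSnd f ≫ (Hom.ofMap f hf : X ⟶ Y) := by
  have h₁ := graph_intro f X.pred fun p : (kernel f).carrier => p.1.1
  have h₂ := graph_intro f X.pred fun p : (kernel f).carrier => p.1.2
  refine Hom.eq_of_tracked (X := kernel f) (Y := Y) (fun p : (kernel f).carrier => f p.1.1) ?_ ?_
  · exact Hom.comp_tracked (Hom.ofMap_tracked _ _) (inf_le_left.trans h₁)
  · refine Hom.comp_tracked (f := fun p : (kernel f).carrier => p.1.2) (Hom.ofMap_tracked _ _) ?_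
    have e : (fun p : (kernel f).carrier => (p.1.2, f p.1.1)) = fun p => (p.1.2, f p.1.2) :=
      funext fun p => Prod.ext rfl p.2
    rw [e]
    exact inf_le_right.trans h₂

/-- The pair `(u, v)` is an element of the kernel, related to `w` through its first projection. By
`hk` it is also related to `w` through the second, whose graph sends it to nothing but `v`. This
makes the descended relation functional. -/
theorem Hom.rel_le_of_kernel_condition {k : X ⟶ W} (hk : kernelFst f ≫ k = kernelSnd f ≫ k)
    {Z : Type u} (u v : Z → X.carrier) (w : Z → W.carrier) (huv : ∀ z, f (u z) = f (v z)) :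
    reindex (fun z => (u z, w z)) (Hom.rel (X := X) (Y := W) k) ⊓ reindex v X.pred ≤
      reindex (fun z => (v z, w z)) (Hom.rel (X := X) (Y := W) k) := by
  let t : Z → (kernel f).carrier := fun z => ⟨(u z, v z), huv z⟩
  have h₁ : reindex (fun z => (u z, w z)) (Hom.rel (X := X) (Y := W) k) ⊓ reindex v X.pred ≤
      reindex (fun z => (t z, w z)) (Hom.rel (X := kernel f) (Y := W) (kernelFst f ≫ k)) := by
    have h := comp_intro (Hom.rel (X := kernel f) (Y := X) (kernelFst f))
      (Hom.rel (X := X) (Y := W) k) t u w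
    refine le_trans (le_inf ?_ inf_le_left) h
    have ht : reindex t (reindex (fun p : (kernel f).carrier => p.1.1) X.pred ⊓
        reindex (fun p : (kernel f).carrier => p.1.2) X.pred) =
          reindex u X.pred ⊓ reindex v X.pred := by
      rw [map_inf, reindex_reindex, reindex_reindex]
    refine le_trans (le_inf (inf_le_left.trans (Hom.le_left k _ _)) inf_le_right) ?_
    exact ht.ge.trans (graph_intro (fun p : (kernel f).carrier => p.1.1) (kernel f).pred t)
  rw [hk] at h₁
  refine (le_inf h₁ le_top).trans (comp_elim _ _ _ _ ?_)
  rw [map_top, inf_top_eq]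
  refine graph_elim _ _ _ _ ?_
  simp only [reindex_reindex]
  refine inf_le_right.trans (le_of_eq ?_)
  congr 1; congr 1
  funext z; exact Prod.ext z.2.symm rfl

/-- The morphism induced on the image of a function by a morphism compatible with its kernel. -/
def Hom.descend (hf : X.pred ≤ reindex f Y.pred) (hs : Y.pred ≤ exist f X.pred) (k : X ⟶ W)
    (hk : kernelFst f ≫ k = kernelSnd f ≫ k) : Hom Y W where
  rel := exist (fun p => (f p.1, p.2)) (Hom.rel (X := X) (Y := W) k)
  le := by
    rw [gc_exist]
    simp only [map_inf, reindex_reindex]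
    refine le_inf ?_ ((Hom.le k).trans inf_le_right)
    have h := reindex_mono Prod.fst hf (I := X.carrier × W.carrier)
    rw [reindex_reindex] at h
    exact ((Hom.le k).trans inf_le_left).trans h
  total := by
    -- Surjectivity of `f` is what makes the image relation total.
    refine hs.trans ?_
    rw [gc_exist]
    refine (Hom.total k).trans ?_
    rw [gc_exist, reindex_reindex]
    exact (le_exist (fun p : X.carrier × W.carrier => (f p.1, p.2)) (Hom.rel (X := X) (Y := W) k)).trans
      (exist_fst_intro _ _ _)
  functional := by
    refine image_elim _ _ _ _ ?_
    rw [inf_comm, reindex_reindex]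
    refine image_elim _ _ _ _ ?_
    simp only [reindex_reindex]
    let P := {p : {p : (Y.carrier × W.carrier × W.carrier) × X.carrier // f p.2 = p.1.1} ×
      X.carrier // f p.2 = p.1.1.1.1}
    -- The two values come with possibly different preimages of the same point. The second is
    -- transported to the first preimage, where functionality of `k` compares both values.
    have h₁ := Hom.rel_le_of_kernel_condition hk (fun p : P => p.1.2) (fun p => p.1.1.1.2)
      (fun p => p.1.1.1.1.2.2) fun p => p.2.trans p.1.1.2.symm
    have h₂ := IsFunctional.apply (Hom.functional k)
      (fun p : P => p.1.1.1.2) (fun p => p.1.1.1.1.2.1) (fun p => p.1.1.1.1.2.2)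
    refine le_trans (le_inf inf_le_right ?_) h₂
    exact le_trans (le_inf inf_le_left (inf_le_right.trans (Hom.le_left k _ _))) h₁

/-- The graph of a surjective function is a regular epimorphism. -/
theorem isRegularEpi_ofMap (hf : X.pred ≤ reindex f Y.pred) (hs : Y.pred ≤ exist f X.pred) :
    IsRegularEpi (X := X) (Y := Y) (Hom.ofMap f hf) := by
  refine ⟨⟨⟨kernel f, kernelFst f, kernelSnd f, kernel_condition hf,
    Limits.Cofork.IsColimit.mk _ (fun s => Hom.descend hf hs s.π s.condition) (fun s => ?_)
      (fun s m hm => ?_)⟩⟩⟩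
  -- One inequality suffices: `f x` is the intermediate witness for a pair `(x, w)` related by
  -- `s.π`.
  · refine (Hom.eq_of_le ?_).symm
    have h := comp_intro (Hom.ofMap f hf).rel (Hom.descend hf hs s.π s.condition).rel
      (fun p : X.carrier × s.pt.carrier => p.1) (fun p => f p.1) (fun p => p.2)
    refine le_trans (le_inf ?_ ?_) (h.trans (reindex_id (Reg.comp _ _)).le)
    · exact ((Hom.le s.π).trans inf_le_left).trans (graph_intro f X.pred _)
    · exact le_exist (fun p : X.carrier × s.pt.carrier => (f p.1, p.2)) (Hom.rel s.π)
  -- By adjunction it is enough that `s.π(x, w)` implies `m(f x, w)`, and `s.π` is the graph of `f`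
  -- followed by `m`.
  · refine (Hom.eq_of_le ?_).symm
    change exist (fun p => (f p.1, p.2)) (Hom.rel s.π) ≤ Hom.rel m
    rw [gc_exist, ← hm]
    refine le_of_forall_reindex (comp_elim _ _ _ _ ?_)
    rw [map_top, inf_top_eq]
    refine graph_elim _ _ _ _ ?_
    simp only [reindex_reindex]
    refine inf_le_right.trans (le_of_eq ?_)
    congr 1; congr 1
    funext z; exact Prod.ext z.2.symm rfl

end Quotient

/-! ### The two implications -/

theorem isSupercompact_of_isRegularProjective (hX : X.IsStronglyTrackable)
    (h : IsRegularProjective X) : X.pred.IsSupercompact := by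
  intro J f ψ hψ
  -- The second conjunct is needed for `f` to define a morphism into `X`.
  let V : Reg A := ⟨J, ψ ⊓ reindex f X.pred⟩
  have hf : V.pred ≤ reindex f X.pred := inf_le_right
  have hs : X.pred ≤ exist f V.pred := le_exist_inf_reindex f hψ
  have := isRegularEpi_ofMap (X := V) (Y := X) hf hs
  obtain ⟨s, hs⟩ := h (Hom.ofMap f hf : V ⟶ X) (𝟙 X)
  obtain ⟨g, hg, -⟩ := hX V s
  have hgV : X.pred ≤ reindex g V.pred := hg.trans (Hom.le_right s _ _)
  refine ⟨g, hgV.trans (reindex_mono g inf_le_left), ?_⟩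
  -- Uniqueness of tracking gives equality of functions on the whole carrier, not merely up to the
  -- internal equality on `X.pred`.
  refine (hX X (𝟙 X)).unique ?_ ?_
  · rw [← hs]
    exact Hom.comp_tracked hg (hgV.trans (graph_intro f V.pred g))
  · have h := idRel_intro X.pred fun a => a
    rwa [reindex_id] at h

theorem isRegularProjective_of_isSupercompact (hX : X.IsStronglyTrackable)
    (h : X.pred.IsSupercompact) : IsRegularProjective X := by
  intro Y W e _ φ
  obtain ⟨f, hf, -⟩ := hX W φ
  have h₁ : X.pred ≤ reindex f (exist Prod.snd (Hom.rel e)) :=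
    (hf.trans (Hom.le_right φ _ _)).trans (reindex_mono f (le_exist_snd_of_isRegularEpi e))
  -- Beck–Chevalley presents the predicate as an existential along the projection of the pullback
  -- `{(a, (y, c)) | c = f a}`, the form to which supercompactness applies.
  rw [reindex_exist] at h₁
  obtain ⟨g, hg, hgf⟩ := h _ _ _ h₁
  rw [reindex_reindex] at hg
  -- The strict section property puts `g a` in the fibre over `a`, so its last component is exactly
  -- `f a`.
  have e₁ : (fun a => (g a).1.2) = fun a => ((g a).1.2.1, f a) :=
    funext fun a => Prod.ext rfl ((g a).2.trans (congrArg f (congrFun hgf a)))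
  rw [e₁] at hg
  refine ⟨Hom.ofMap (fun a => (g a).1.2.1) (hg.trans (Hom.le_left e _ _)), ?_⟩
  exact Hom.eq_of_tracked f (Hom.comp_tracked (Hom.ofMap_tracked _ _) hg) hf

end Reg

end ImplicativeAlgebra

theorem mainTheorem5 {A : Type u} [ImplicativeAlgebra A] (X : ImplicativeAlgebra.Reg A)
    (hX : X.IsStronglyTrackable) :
    IsRegularProjective X ↔ X.pred.IsSupercompact :=
  ⟨ImplicativeAlgebra.Reg.isSupercompact_of_isRegularProjective hX,
    ImplicativeAlgebra.Reg.isRegularProjective_of_isSupercompact hX⟩
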